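/- **Theorem 3.1.** Let $f:\mathbb{C}\to\mathbb{C}$ be a transcendental entire function, i.e. an entire function that is not a polynomial, and let $f^n$ denote its $n$-th iterate. Let $F(f)$ be the Fatou set of $f$, i.e. the set of $z\in\mathbb{C}$ such that $(f^n)_{n\in\mathbb{N}}$ is a normal family in a neighbourhood of $z$ (every sequence of iterates has a subsequence that converges locally uniformly there, to a finite limit function or to $\infty$). Let $J(f)=\mathbb{C}\setminus F(f)$ be the Julia set and $I(f)=\{z : f^n(z)\to\infty \text{ as } n\to\infty\}$ the escaping set. A Fatou component is a connected component of $F(f)$, and it is called multiply connected if it is not simply connected. Let $z_0\in I(f)$ and put $z_n=f^n(z_0)$ for $n\ge 0$. Suppose that there exist $\lambda>1$ and an integer $N\ge 0$ such that $$f(z_n)\neq 0\quad\text{and}\quad \left|z_n\,\frac{f'(z_n)}{f(z_n)}\right|\ge\lambda\qquad\text{for all } n\ge N.$$ Then either $z_0$ lies in a multiply connected Fatou component of $f$, or $z_0\in J(f)$. -/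

import Mathlib

open Filter Topology Set

namespace EntireDynamics

/-- A transcendental entire function: holomorphic on all of `ℂ` and not a polynomial. -/
def IsTranscendentalEntire (f : ℂ → ℂ) : Prop :=
  Differentiable ℂ f ∧ ¬ ∃ p : Polynomial ℂ, ∀ z : ℂ, f z = p.eval z

/-- `g k → ∞` uniformly on every compact subset of `U`. -/
def TendstoInftyLocallyUniformlyOn (g : ℕ → ℂ → ℂ) (U : Set ℂ) : Prop :=
  ∀ K : Set ℂ, K ⊆ U → IsCompact K → ∀ M : ℝ, ∀ᶠ k in atTop, ∀ z ∈ K, M < ‖g k z‖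

/-- Normality of the family `(F i)` on the set `U`, in the classical sense for holomorphic
functions: every sequence of members has a subsequence which on `U` converges locally uniformly,
either to a finite function or to `∞`. -/
def IsNormalFamilyOn {ι : Type*} (F : ι → ℂ → ℂ) (U : Set ℂ) : Prop :=
  ∀ s : ℕ → ι, ∃ φ : ℕ → ℕ, StrictMono φ ∧
    ((∃ g : ℂ → ℂ, TendstoLocallyUniformlyOn (fun k => F (s (φ k))) g atTop U) ∨
      TendstoInftyLocallyUniformlyOn (fun k => F (s (φ k))) U)

/-- The Fatou set: the points that have an open neighbourhood on which the iterates of `f` form a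
normal family. (The neighbourhood may be shrunk to a disc, so nothing is lost by asking for a limit
that is finite everywhere or `∞` everywhere.) -/
def fatouSet (f : ℂ → ℂ) : Set ℂ :=
  {z | ∃ U : Set ℂ, IsOpen U ∧ z ∈ U ∧ IsNormalFamilyOn (fun n : ℕ => f^[n]) U}

/-- The Julia set: the complement of the Fatou set in `ℂ`. -/
def juliaSet (f : ℂ → ℂ) : Set ℂ := (fatouSet f)ᶜ

/-- The escaping set: the points whose iterates tend to `∞`. -/
def escapingSet (f : ℂ → ℂ) : Set ℂ :=
  {z | Tendsto (fun n : ℕ => ‖f^[n] z‖) atTop atTop}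

/-- A Fatou component: a connected component of the Fatou set. -/
def IsFatouComponent (f : ℂ → ℂ) (U : Set ℂ) : Prop :=
  ∃ z ∈ fatouSet f, U = connectedComponentIn (fatouSet f) z

/-- A multiply connected Fatou component: one that is not simply connected. -/
def IsMultiplyConnectedFatouComponent (f : ℂ → ℂ) (U : Set ℂ) : Prop :=
  IsFatouComponent f U ∧ ¬ IsSimplyConnected U

end EntireDynamics

/-!
The argument is by contradiction: let `z₀` be an escaping Fatou point whose Fatou component `U` is
simply connected, and let `c` be a point of the Julia set.

Multiplying the hypothesis on `z f'(z) / f(z)` along the orbit shows that the logarithmic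
derivatives of `f^[k] - c` at a fixed orbit point `w` grow geometrically
(`pow_mul_norm_le_norm_deriv_iterate`). They are nevertheless bounded. Indeed, a circle about `c`
through a point of `f^[n] '' U` that surrounds `z₀` meets the Julia set
(`exists_mem_juliaSet_norm_sub_eq`). Otherwise it would lie in the Fatou set. If `U` is bounded, its
preimage in `U` under `f^[n]` would then be compact; if `U` is unbounded, the circle itself would be
contained in `U`. Both are impossible on a simply connected set, where `log (f^[n] - c)` and
`log (z - c)` have continuous branches: a compact level set of the modulus would contain a point with
maximal argument (`not_isCompact_level`). As the iterates omit the Julia set on a disc in the Fatou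
set, a branch of `log (f^[k] - c)` there omits on each vertical line through its image a translate
of `2πiℤ`, so it covers no disc of radius `4`, and Bloch's theorem
(`norm_deriv_mul_le_of_forall_not_ball_subset_image`) bounds its derivative
(`norm_deriv_iterate_mul_le`).

That the Julia set is nonempty is again a consequence of Bloch's theorem, through Picard's little
theorem: `f` has a point of period at most two (`IsTranscendentalEntire.exists_apply_apply_eq`),
whereas all points would escape along with `z₀` if the Fatou set were the whole plane
(`escapingSet_eq_univ`).
-/

namespace EntireDynamics

open Metric

/-! ### Bloch's theorem -/

/-- **Bloch's theorem**, with a crude constant: a holomorphic function on a disc of radius `r`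
whose image contains no disc of radius `ρ` has derivative at most `96 * ρ / r` at the centre. -/
theorem norm_deriv_mul_le_of_forall_not_ball_subset_image {g : ℂ → ℂ} {a : ℂ} {r ρ : ℝ}
    (hr : 0 < r) (hg : DifferentiableOn ℂ g (ball a r))
    (hρ : ∀ w, ¬ ball w ρ ⊆ g '' ball a r) : ‖deriv g a‖ * r ≤ 96 * ρ := by
  by_contra! hlt
  have hρ0 : 0 < ρ := by
    by_contra! h
    exact hρ 0 (by simp [ball_eq_empty.2 h])
  -- Landau's trick: on the half disc, maximize the derivative weighted by the distance to the
  -- boundary; near the maximum point the derivative is then at most doubled.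
  have hd : DifferentiableOn ℂ (deriv g) (ball a r) := hg.deriv isOpen_ball
  have hsub : closedBall a (r / 2) ⊆ ball a r := closedBall_subset_ball (by linarith)
  obtain ⟨b, hb, hmax⟩ := (isCompact_closedBall a (r / 2)).exists_isMaxOn
    (f := fun z => (r / 2 - dist z a) * ‖deriv g z‖) ⟨a, mem_closedBall_self (by linarith)⟩
    ((by fun_prop : Continuous fun z => r / 2 - dist z a).continuousOn.mul
      (hd.continuousOn.mono hsub).norm)
  have hM : r / 2 * ‖deriv g a‖ ≤ (r / 2 - dist b a) * ‖deriv g b‖ := by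
    simpa using hmax (mem_closedBall_self (by linarith) : a ∈ closedBall a (r / 2))
  set t := (r / 2 - dist b a) / 2 with ht
  set A := ‖deriv g b‖ with hA
  have hMpos : 96 * ρ < 4 * t * A := by
    have : 4 * t * A = 2 * ((r / 2 - dist b a) * A) := by rw [ht]; ring
    linarith
  have hdist : 0 ≤ r / 2 - dist b a := by
    have := mem_closedBall.1 hb; linarith
  have hA0 : 0 < A := by
    rcases (norm_nonneg (deriv g b)).eq_or_lt with h | h
    · rw [← hA] at h; rw [← h] at hMpos; linarith
    · exact h
  have ht0 : 0 < t := by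
    by_contra! h; nlinarith
  have hball : ∀ z ∈ ball b t, z ∈ closedBall a (r / 2) ∧ t ≤ r / 2 - dist z a := by
    intro z hz
    have h1 := dist_triangle z b a
    have h2 := mem_ball.1 hz
    have : t ≤ r / 2 - dist z a := by linarith
    exact ⟨mem_closedBall.2 (by linarith), this⟩
  have hdouble : ∀ z ∈ ball b t, ‖deriv g z‖ ≤ 2 * A := by
    intro z hz
    obtain ⟨h1, h2⟩ := hball z hz
    have h3 : (r / 2 - dist z a) * ‖deriv g z‖ ≤ (r / 2 - dist b a) * A := hmax h1
    have h4 : t * ‖deriv g z‖ ≤ t * (2 * A) := by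
      nlinarith [mul_le_mul_of_nonneg_right h2 (norm_nonneg (deriv g z))]
    exact le_of_mul_le_mul_left h4 ht0
  have hsubt : ball b t ⊆ ball a r := fun z hz => hsub (hball z hz).1
  have hlip : ∀ z ∈ ball b t, ‖deriv g z - deriv g b‖ ≤ 3 * A / t * ‖z - b‖ := by
    intro z hz
    have := Complex.dist_le_div_mul_dist_of_mapsTo_ball (hd.mono hsubt) (R₂ := 3 * A)
      (fun w hw => by
        rw [mem_closedBall, dist_eq_norm]
        have := norm_sub_le (deriv g w) (deriv g b)
        have := hdouble w hw
        linarith) hz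
    simpa [dist_eq_norm] using this
  have hsub6 : closedBall b (t / 6) ⊆ ball b t := closedBall_subset_ball (by linarith)
  have hdiffat : ∀ z ∈ ball b t, HasDerivAt g (deriv g z) z := fun z hz =>
    ((hg z (hsubt hz)).differentiableAt (isOpen_ball.mem_nhds (hsubt hz))).hasDerivAt
  have hmv : ∀ z ∈ sphere b (t / 6), A * t / 12 ≤ ‖g z - g b‖ := by
    intro z hz
    have hz6 : ‖z - b‖ = t / 6 := by simpa [dist_eq_norm] using hz
    have hkey := (convex_closedBall b (t / 6)).norm_image_sub_le_of_norm_hasDerivWithin_le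
      (f := fun w => g w - deriv g b * w) (f' := fun w => deriv g w - deriv g b) (C := A / 2)
      (x := b) (y := z)
      (fun w hw => ((hdiffat w (hsub6 hw)).sub
        (by simpa using (hasDerivAt_id w).const_mul (deriv g b))).hasDerivWithinAt)
      (fun w hw => by
        refine (hlip w (hsub6 hw)).trans ?_
        have : ‖w - b‖ ≤ t / 6 := by simpa [dist_eq_norm] using hw
        calc 3 * A / t * ‖w - b‖ ≤ 3 * A / t * (t / 6) := by gcongr
          _ = A / 2 := by field_simp; norm_num)
      (mem_closedBall_self (by linarith)) (sphere_subset_closedBall hz)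
    have h1 : ‖deriv g b * (z - b)‖ = A * (t / 6) := by rw [norm_mul, hz6]
    have h2 := norm_sub_norm_le (deriv g b * (z - b)) (deriv g b * (z - b) - (g z - g b))
    rw [sub_sub_cancel, h1] at h2
    have h3 : g z - deriv g b * z - (g b - deriv g b * b)
        = -(deriv g b * (z - b) - (g z - g b)) := by ring
    simp only [h3, norm_neg, hz6] at hkey
    linarith
  have hcl : DiffContOnCl ℂ g (ball b (t / 6)) :=
    (hg.mono (hsub6.trans hsubt)).diffContOnCl_ball Subset.rfl
  have himg := hcl.ball_subset_image_closedBall (by linarith) hmv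
    (((hdiffat b (mem_ball_self ht0)).eventually_ne
      (norm_pos_iff.1 hA0)).frequently.filter_mono nhdsWithin_le_nhds)
  refine hρ (g b) ((ball_subset_ball ?_).trans (himg.trans (image_mono (hsub6.trans hsubt))))
  linarith

/-! ### Holomorphic logarithms and Picard's little theorem -/

/-- A nonvanishing holomorphic function whose logarithmic derivative has a primitive has a
holomorphic logarithm. -/
theorem exists_hasDerivAt_exp_eq {h : ℂ → ℂ} {V : Set ℂ} (hV : IsOpen V) (hVc : IsPreconnected V)
    (hh : DifferentiableOn ℂ h V) (h0 : ∀ z ∈ V, h z ≠ 0) {a : ℂ} (ha : a ∈ V)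
    (hex : Complex.IsExactOn (fun z => deriv h z / h z) V) :
    ∃ k : ℂ → ℂ, ∀ z ∈ V, HasDerivAt k (deriv h z / h z) z ∧ Complex.exp (k z) = h z := by
  obtain ⟨k, hka, hk⟩ := hex.with_val_at a (Complex.log (h a))
  have hderiv : ∀ z ∈ V, HasDerivAt (fun z => h z * Complex.exp (-k z)) 0 z := by
    intro z hz
    have h1 := ((hh z hz).differentiableAt (hV.mem_nhds hz)).hasDerivAt
    convert! h1.mul (hk z hz).neg.cexp using 1
    field_simp [h0 z hz]
    ring
  refine ⟨k, fun z hz => ⟨hk z hz, ?_⟩⟩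
  have hc : h z * Complex.exp (-k z) = h a * Complex.exp (-k a) :=
    hV.is_const_of_deriv_eq_zero hVc
      (fun w hw => (hderiv w hw).differentiableAt.differentiableWithinAt)
      (fun w hw => (hderiv w hw).deriv) hz ha
  rw [hka, Complex.exp_neg, Complex.exp_neg, Complex.exp_log (h0 a ha),
    mul_inv_cancel₀ (h0 a ha)] at hc
  field_simp at hc
  exact hc.symm

theorem exists_hasDerivAt_exp_eq_of_ball {h : ℂ → ℂ} {a : ℂ} {r : ℝ} (hr : 0 < r)
    (hh : DifferentiableOn ℂ h (ball a r)) (h0 : ∀ z ∈ ball a r, h z ≠ 0) :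
    ∃ k : ℂ → ℂ, ∀ z ∈ ball a r, HasDerivAt k (deriv h z / h z) z ∧ Complex.exp (k z) = h z :=
  exists_hasDerivAt_exp_eq isOpen_ball (convex_ball a r).isPreconnected hh h0 (mem_ball_self hr)
    (DifferentiableOn.isExactOn_ball ((hh.deriv isOpen_ball).div hh h0))

theorem exists_differentiable_exp_eq {h : ℂ → ℂ} (hh : Differentiable ℂ h) (h0 : ∀ z, h z ≠ 0) :
    ∃ k : ℂ → ℂ, Differentiable ℂ k ∧ ∀ z, Complex.exp (k z) = h z := by
  obtain ⟨k, hk⟩ := exists_hasDerivAt_exp_eq isOpen_univ isPreconnected_univ hh.differentiableOn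
    (fun z _ => h0 z) (mem_univ 0)
    (Differentiable.isExactOn_univ (hh.deriv.div hh h0))
  exact ⟨k, fun z => (hk z trivial).1.differentiableAt, fun z => (hk z trivial).2⟩

/-- Near every nonnegative real there is a point where `cosh` is an odd integer. -/
theorem exists_cosh_eq_odd_of_nonneg {y : ℝ} (hy : 0 ≤ y) :
    ∃ x : ℝ, |x - y| ≤ 2 ∧ ∃ m : ℤ, Real.cosh x = 2 * m - 1 := by
  have h2 : 3 ≤ Real.cosh 2 := by
    have h := Real.cosh_two_mul 1
    have h1 : 1 ≤ Real.sinh 1 := Real.self_le_sinh_iff.2 zero_le_one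
    rw [Real.cosh_sq, mul_one] at h
    nlinarith
  have hgap : Real.cosh y + 2 ≤ Real.cosh (y + 2) := by
    rw [Real.cosh_add]
    have h1 := Real.one_le_cosh y
    have h3 : 0 ≤ Real.sinh y * Real.sinh 2 :=
      mul_nonneg (Real.sinh_nonneg_iff.2 hy) (Real.sinh_nonneg_iff.2 (by norm_num))
    nlinarith
  -- `2 * ⌈(cosh y + 1) / 2⌉ - 1` is the least odd integer above `cosh y`.
  have hceil := Int.le_ceil ((Real.cosh y + 1) / 2)
  have hceil' := Int.ceil_lt_add_one ((Real.cosh y + 1) / 2)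
  obtain ⟨x, hx, hxm⟩ := intermediate_value_Icc (by linarith : y ≤ y + 2)
    Real.continuous_cosh.continuousOn
    (⟨by linarith, by linarith⟩ : (2 * (⌈(Real.cosh y + 1) / 2⌉ : ℝ) - 1) ∈
      Icc (Real.cosh y) (Real.cosh (y + 2)))
  exact ⟨x, abs_le.2 ⟨by linarith [hx.1], by linarith [hx.2]⟩, _, hxm⟩

theorem exists_cosh_eq_odd (y : ℝ) :
    ∃ x : ℝ, |x - y| ≤ 2 ∧ ∃ m : ℤ, Real.cosh x = 2 * m - 1 := by
  rcases le_total 0 y with hy | hy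
  · exact exists_cosh_eq_odd_of_nonneg hy
  · obtain ⟨x, hx, m, hm⟩ := exists_cosh_eq_odd_of_nonneg (neg_nonneg.2 hy)
    refine ⟨-x, ?_, m, by rw [Real.cosh_neg, hm]⟩
    rw [← abs_neg]; convert! hx using 2; ring

/-- The points where `cosh` is an odd integer are relatively dense in the plane. -/
theorem exists_mem_ball_cosh_eq_odd (w : ℂ) :
    ∃ ζ ∈ ball w 6, ∃ m : ℤ, Complex.cosh ζ = 2 * m - 1 := by
  obtain ⟨x, hx, m, hm⟩ := exists_cosh_eq_odd w.re
  set j : ℤ := round (w.im / Real.pi) with hj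
  have hj' : |w.im / Real.pi - j| ≤ 1 / 2 := abs_sub_round _
  have hjpi : |j * Real.pi - w.im| ≤ 2 := by
    have : j * Real.pi - w.im = -((w.im / Real.pi - j) * Real.pi) := by
      field_simp [Real.pi_ne_zero]; ring
    rw [this, abs_neg, abs_mul, abs_of_pos Real.pi_pos]
    nlinarith [Real.pi_lt_four, Real.pi_pos]
  refine ⟨x + (j * Real.pi : ℝ) * Complex.I, ?_, ?_⟩
  · rw [mem_ball, dist_eq_norm]
    refine (Complex.norm_le_abs_re_add_abs_im _).trans_lt ?_
    simp only [Complex.sub_re, Complex.add_re, Complex.ofReal_re, Complex.re_ofReal_mul,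
      Complex.I_re, Complex.sub_im, Complex.add_im, Complex.ofReal_im, Complex.im_ofReal_mul,
      Complex.I_im, mul_zero, add_zero, zero_add, mul_one]
    linarith
  · have hmC : Complex.cosh x = 2 * m - 1 := by
      rw [← Complex.ofReal_cosh, hm]; push_cast; ring
    have hsin : Complex.sin ((j * Real.pi : ℝ) : ℂ) = 0 := by
      rw [← Complex.ofReal_sin, Real.sin_int_mul_pi]; simp
    rw [Complex.cosh_add, Complex.cosh_mul_I, Complex.sinh_mul_I, hsin, hmC,
      ← Complex.ofReal_cos, Real.cos_int_mul_pi]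
    rcases Int.even_or_odd j with he | ho
    · exact ⟨m, by simp [he.neg_one_zpow]⟩
    · exact ⟨1 - m, by simp [ho.neg_one_zpow]; ring⟩

/-- **Picard's little theorem** for the values `0` and `1`, by Landau's representation
`exp (π i (1 + cosh H))` of a function omitting them: `H` stays away from a relatively dense set,
so Bloch's theorem on arbitrarily large discs makes it constant. -/
theorem exists_eq_const_of_forall_ne_zero_of_forall_ne_one {F : ℂ → ℂ} (hF : Differentiable ℂ F)
    (h0 : ∀ z, F z ≠ 0) (h1 : ∀ z, F z ≠ 1) : ∃ κ, ∀ z, F z = κ := by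
  have h2pi : (2 * Real.pi * Complex.I : ℂ) ≠ 0 := Complex.two_pi_I_ne_zero
  obtain ⟨k, hk, hkF⟩ := exists_differentiable_exp_eq hF h0
  set α : ℂ → ℂ := fun z => k z / (2 * Real.pi * Complex.I) with hα
  have hαd : Differentiable ℂ α := hk.div_const _
  have hkα : ∀ z, k z = α z * (2 * Real.pi * Complex.I) := fun z => by
    simp only [hα]; field_simp
  have hαint : ∀ z (m : ℤ), α z ≠ m := by
    intro z m hm
    apply h1 z
    rw [← hkF, hkα, hm, Complex.exp_int_mul_two_pi_mul_I]
  obtain ⟨u, hu, hue⟩ := exists_differentiable_exp_eq hαd (fun z => by simpa using hαint z 0)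
  obtain ⟨v, hv, hve⟩ := exists_differentiable_exp_eq (hαd.sub_const 1)
    (fun z => by simpa [sub_eq_zero] using hαint z 1)
  set p : ℂ → ℂ := fun z => Complex.exp (u z / 2) with hp
  set q : ℂ → ℂ := fun z => Complex.exp (v z / 2) with hq
  have hpsq : ∀ z, p z ^ 2 = α z := fun z => by
    rw [← hue, hp, ← Complex.exp_nat_mul]; congr 1; push_cast; ring
  have hqsq : ∀ z, q z ^ 2 = α z - 1 := fun z => by
    rw [← hve, hq, ← Complex.exp_nat_mul]; congr 1; push_cast; ring
  have hpq : ∀ z, (p z - q z) * (p z + q z) = 1 := fun z => by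
    linear_combination hpsq z - hqsq z
  obtain ⟨G, hG, hGe⟩ := exists_differentiable_exp_eq (h := fun z => p z - q z)
    ((hu.div_const 2).cexp.sub (hv.div_const 2).cexp)
    (fun z => left_ne_zero_of_mul_eq_one (hpq z))
  have hGneg : ∀ z, Complex.exp (-G z) = p z + q z := fun z => by
    rw [Complex.exp_neg, hGe]; exact inv_eq_of_mul_eq_one_right (hpq z)
  have hcosh : ∀ z, Complex.cosh (2 * G z) = 2 * α z - 1 := fun z => by
    have h3 : Complex.cosh (G z) = p z := by
      rw [Complex.cosh, hGe, hGneg]; ring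
    have h4 := Complex.cosh_sq_sub_sinh_sq (G z)
    rw [Complex.cosh_two_mul]
    linear_combination 2 * hpsq z - h4 + 2 * (Complex.cosh (G z) + p z) * h3
  have hHd : Differentiable ℂ fun z => 2 * G z := hG.const_mul 2
  have hderiv : ∀ z, deriv (fun z => 2 * G z) z = 0 := by
    intro z
    have hb : ∀ r : ℝ, 0 < r → ‖deriv (fun z => 2 * G z) z‖ * r ≤ 96 * 6 := fun r hr =>
      norm_deriv_mul_le_of_forall_not_ball_subset_image hr hHd.differentiableOn fun w hw => by
        obtain ⟨ζ, hζ, m, hm⟩ := exists_mem_ball_cosh_eq_odd w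
        obtain ⟨y, -, hy⟩ := hw hζ
        simp only at hy
        rw [← hy, hcosh] at hm
        exact hαint y m (by linear_combination hm / 2)
    by_contra hne
    have hpos := norm_pos_iff.2 hne
    have := hb (577 / ‖deriv (fun z => 2 * G z) z‖) (by positivity)
    rw [mul_div_cancel₀ _ hpos.ne'] at this
    norm_num at this
  have hconst := is_const_of_deriv_eq_zero hHd hderiv
  refine ⟨F 0, fun z => ?_⟩
  have : α z = α 0 := by
    have h3 := hcosh z
    rw [hconst z 0, hcosh 0] at h3
    linear_combination -h3 / 2
  rw [← hkF, ← hkF 0, hkα, hkα, this]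

/-- **Picard's little theorem**: an entire function omitting two values is constant. -/
theorem exists_eq_const_of_forall_ne {F : ℂ → ℂ} (hF : Differentiable ℂ F) {a b : ℂ} (hab : a ≠ b)
    (ha : ∀ z, F z ≠ a) (hb : ∀ z, F z ≠ b) : ∃ κ, ∀ z, F z = κ := by
  have hba : b - a ≠ 0 := sub_ne_zero.2 hab.symm
  obtain ⟨κ, hκ⟩ := exists_eq_const_of_forall_ne_zero_of_forall_ne_one
    (F := fun z => (F z - a) / (b - a)) ((hF.sub_const a).div_const _)
    (fun z => div_ne_zero (sub_ne_zero.2 (ha z)) hba)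
    (fun z h => hb z (by rw [div_eq_one_iff_eq hba] at h; linear_combination h))
  refine ⟨κ * (b - a) + a, fun z => ?_⟩
  rw [← hκ z]; field_simp; ring

/-! ### Invariance of the Fatou set -/

variable {f : ℂ → ℂ}

theorem isOpen_fatouSet : IsOpen (fatouSet f) :=
  isOpen_iff_forall_mem_open.2 fun _ ⟨U, hU, hz, hn⟩ => ⟨U, fun _ hw => ⟨U, hU, hw, hn⟩, hU, hz⟩

theorem IsTranscendentalEntire.isOpenMap (hf : IsTranscendentalEntire f) : IsOpenMap f := by
  refine (AnalyticOnNhd.is_constant_or_isOpenMap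
    (Complex.analyticOnNhd_univ_iff_differentiable.2 hf.1)).resolve_left ?_
  rintro ⟨w, hw⟩
  exact hf.2 ⟨Polynomial.C w, by simpa using hw⟩

theorem mem_fatouSet_of_apply_mem (hf : Continuous f) {z : ℂ} (hz : f z ∈ fatouSet f) :
    z ∈ fatouSet f := by
  obtain ⟨U, hU, hzU, hn⟩ := hz
  refine ⟨f ⁻¹' U, hU.preimage hf, hzU, fun s => ?_⟩
  by_cases hs : ∃ᶠ k in atTop, s k = 0
  · -- Infinitely many members of the sequence are the identity.
    obtain ⟨φ, hφ, hφs⟩ := extraction_of_frequently_atTop hs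
    refine ⟨φ, hφ, Or.inl ⟨id, ?_⟩⟩
    simp only [hφs, Function.iterate_zero]
    exact fun u hu x _ => ⟨univ, univ_mem, Eventually.of_forall fun n y _ => refl_mem_uniformity hu⟩
  · obtain ⟨K, hK⟩ := eventually_atTop.1 (not_frequently.1 hs)
    obtain ⟨φ, hφ, h⟩ := hn fun k => s (k + K) - 1
    have hiter : ∀ k, f^[s (φ k + K)] = f^[s (φ k + K) - 1] ∘ f := fun k => by
      rw [← Function.iterate_succ, Nat.succ_eq_add_one,
        Nat.sub_add_cancel (Nat.one_le_iff_ne_zero.2 (hK _ (by omega)))]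
    refine ⟨fun k => φ k + K, fun a b hab => Nat.add_lt_add_right (hφ hab) K, ?_⟩
    simp only [hiter]
    refine h.imp ?_ ?_
    · rintro ⟨g, hg⟩
      exact ⟨g ∘ f, hg.comp f (mapsTo_preimage f U) hf.continuousOn⟩
    · intro h L hL hLc M
      filter_upwards [h (f '' L) (image_subset_iff.2 hL) (hLc.image hf) M] with k hk z hz
      exact hk _ (mem_image_of_mem f hz)

theorem apply_mem_fatouSet (hfo : IsOpenMap f) {z : ℂ}
    (hz : z ∈ fatouSet f) : f z ∈ fatouSet f := by
  obtain ⟨U, hU, hzU, hn⟩ := hz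
  refine ⟨f '' U, hfo U hU, mem_image_of_mem f hzU, fun s => ?_⟩
  obtain ⟨φ, hφ, h⟩ := hn fun k => s k + 1
  simp only [Function.iterate_succ] at h
  refine ⟨φ, hφ, h.imp ?_ ?_⟩
  · rintro ⟨g, hg⟩
    -- The limit on `f '' U` is `g` composed with any section of `f`, since `g` is constant on the
    -- fibres of `f` by uniqueness of limits.
    have hsec : ∀ w ∈ f '' U, ∃ u ∈ U, f u = w := fun w hw => hw
    choose! σ hσU hσ using hsec
    have hgσ : ∀ u ∈ U, g (σ (f u)) = g u := fun u hu => by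
      have h1 := hg.tendsto_at (hσU _ (mem_image_of_mem f hu))
      have h2 := hg.tendsto_at hu
      simp only [Function.comp_apply, hσ _ (mem_image_of_mem f hu)] at h1 h2
      exact tendsto_nhds_unique h1 h2
    refine ⟨g ∘ σ, ?_⟩
    rintro e he _ ⟨u, hu, rfl⟩
    obtain ⟨t, ht, hev⟩ := hg e he u hu
    rw [hU.nhdsWithin_eq hu] at ht
    refine ⟨f '' (t ∩ U), mem_nhdsWithin_of_mem_nhds
      (hfo.image_mem_nhds (inter_mem ht (hU.mem_nhds hu))), ?_⟩
    filter_upwards [hev] with k hk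
    rintro _ ⟨y, ⟨hyt, hyU⟩, rfl⟩
    simpa [hgσ y hyU] using hk y hyt
  · intro h K hK hKc M
    refine hKc.induction_on (p := fun S => ∀ᶠ k in atTop, ∀ w ∈ S, M < ‖f^[s (φ k)] w‖) (by simp)
      (fun S T hST hT => hT.mono fun k hk w hw => hk w (hST hw))
      (fun S T hS hT => (hS.and hT).mono fun k hk w hw => hw.elim (hk.1 w) (hk.2 w)) ?_
    intro w hw
    obtain ⟨u, hu, rfl⟩ := hK hw
    obtain ⟨L, hL, hLU, hLc⟩ := local_compact_nhds (hU.mem_nhds hu)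
    refine ⟨f '' L, mem_nhdsWithin_of_mem_nhds (hfo.image_mem_nhds hL), ?_⟩
    filter_upwards [h L hLU hLc M] with k hk
    rintro _ ⟨y, hy, rfl⟩
    exact hk y hy

theorem iterate_mem_fatouSet_iff (hf : Continuous f) (hfo : IsOpenMap f) (n : ℕ) {z : ℂ} :
    f^[n] z ∈ fatouSet f ↔ z ∈ fatouSet f := by
  induction n with
  | zero => rfl
  | succ n ih =>
    rw [Function.iterate_succ_apply', ← ih]
    exact ⟨mem_fatouSet_of_apply_mem hf, apply_mem_fatouSet hfo⟩

/-- A Fatou component is relatively closed in the Fatou set. -/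
theorem mem_component_of_mem_closure {x z : ℂ} (hx : x ∈ fatouSet f) (hz : z ∈ fatouSet f)
    (hcl : z ∈ closure (connectedComponentIn (fatouSet f) x)) :
    z ∈ connectedComponentIn (fatouSet f) x := by
  have hpre : IsPreconnected (insert z (connectedComponentIn (fatouSet f) x)) :=
    isPreconnected_connectedComponentIn.subset_closure (subset_insert _ _)
      (insert_subset hcl subset_closure)
  exact hpre.subset_connectedComponentIn
    (mem_insert_of_mem _ (mem_connectedComponentIn hx))
    (insert_subset hz (connectedComponentIn_subset _ _)) (mem_insert _ _)

/-! ### Escaping points of the Fatou set -/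

/-- If a normal family of iterates has an escaping point in its domain, then every sequence of
iterates with exponents tending to infinity has a subsequence tending to `∞`. -/
theorem exists_strictMono_tendstoInfty {U : Set ℂ} (hn : IsNormalFamilyOn (fun n : ℕ => f^[n]) U)
    {z : ℂ} (hz : z ∈ U) (hzI : z ∈ escapingSet f) {s : ℕ → ℕ} (hs : StrictMono s) :
    ∃ φ : ℕ → ℕ, StrictMono φ ∧
      TendstoInftyLocallyUniformlyOn (fun k => f^[s (φ k)]) U := by
  obtain ⟨φ, hφ, ⟨g, hg⟩ | h⟩ := hn s
  · have h1 := (hg.tendsto_at hz).norm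
    have h2 : Tendsto (fun k => ‖f^[s (φ k)] z‖) atTop atTop :=
      (show Tendsto (fun n => ‖f^[n] z‖) atTop atTop from hzI).comp (hs.comp hφ).tendsto_atTop
    exact absurd h1 (not_tendsto_nhds_of_tendsto_atTop h2 _)
  · exact ⟨φ, hφ, h⟩

theorem subset_escapingSet_of_isNormalFamilyOn {U : Set ℂ}
    (hn : IsNormalFamilyOn (fun n : ℕ => f^[n]) U) {z : ℂ} (hz : z ∈ U)
    (hzI : z ∈ escapingSet f) : U ⊆ escapingSet f := by
  intro v hv
  by_contra hvI
  obtain ⟨M, hM⟩ : ∃ M : ℝ, ∃ᶠ n in atTop, ‖f^[n] v‖ < M := by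
    by_contra! h
    exact hvI (tendsto_atTop.2 fun M => by simpa using h M)
  obtain ⟨s, hs, hsM⟩ := extraction_of_frequently_atTop hM
  obtain ⟨φ, hφ, h⟩ := exists_strictMono_tendstoInfty hn hz hzI hs
  obtain ⟨k, hk⟩ := (h {v} (singleton_subset_iff.2 hv) isCompact_singleton M).exists
  exact (hk v rfl).not_gt (hsM _)

/-- If `∞` is the limit of the orbit of a single point and the Fatou set is the whole plane, then
every point escapes, because the escaping set is then open and closed. -/
theorem escapingSet_eq_univ (hF : fatouSet f = univ) (hI : (escapingSet f).Nonempty) :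
    escapingSet f = univ := by
  have hnbhd : ∀ z : ℂ, ∃ U, IsOpen U ∧ z ∈ U ∧ IsNormalFamilyOn (fun n : ℕ => f^[n]) U :=
    fun z => (hF ▸ mem_univ z : z ∈ fatouSet f)
  refine IsClopen.eq_univ ⟨isClosed_of_closure_subset fun z hz => ?_,
    isOpen_iff_forall_mem_open.2 fun z hz => ?_⟩ hI
  · obtain ⟨U, hU, hzU, hn⟩ := hnbhd z
    obtain ⟨w, hwU, hwI⟩ := mem_closure_iff.1 hz U hU hzU
    exact subset_escapingSet_of_isNormalFamilyOn hn hwU hwI hzU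
  · obtain ⟨U, hU, hzU, hn⟩ := hnbhd z
    exact ⟨U, subset_escapingSet_of_isNormalFamilyOn hn hzU hz, hU, hzU⟩

/-- A point of the Fatou set that escapes has a neighbourhood in the Fatou set on which infinitely
many iterates are uniformly as large as desired. -/
theorem exists_ball_frequently_lt_norm_iterate {z : ℂ} (hz : z ∈ fatouSet f)
    (hzI : z ∈ escapingSet f) : ∃ r > 0, ball z r ⊆ fatouSet f ∧
      ∀ M : ℝ, ∃ᶠ n in atTop, ∀ p ∈ ball z r, M < ‖f^[n] p‖ := by
  obtain ⟨U, hU, hzU, hn⟩ := hz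
  obtain ⟨r, hr, hrU⟩ := nhds_basis_closedBall.mem_iff.1 (hU.mem_nhds hzU)
  refine ⟨r, hr, fun w hw => ⟨U, hU, hrU (ball_subset_closedBall hw), hn⟩, fun M => ?_⟩
  obtain ⟨φ, hφ, h⟩ := exists_strictMono_tendstoInfty hn hzU hzI strictMono_id
  refine hφ.tendsto_atTop.frequently (Eventually.frequently ?_)
  filter_upwards [h _ hrU (isCompact_closedBall z r) M] with k hk p hp
  exact hk p (ball_subset_closedBall hp)

/-! ### The Julia set is nonempty -/

theorem notMem_escapingSet_of_isPeriodicPt {z : ℂ} {n : ℕ} (hn : 0 < n)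
    (h : Function.IsPeriodicPt f n z) : z ∉ escapingSet f := by
  intro hI
  have h1 : Tendsto (fun k => ‖f^[n * k] z‖) atTop atTop :=
    (show Tendsto (fun n => ‖f^[n] z‖) atTop atTop from hI).comp
      (tendsto_id.const_mul_atTop' hn)
  simp only [(h.mul_const _).eq] at h1
  exact not_tendsto_const_atTop _ _ h1

/-- A transcendental entire function has a point of period at most two: otherwise the quotient
`(f (f z) - z) / (f z - z)` omits `0` and `1`, hence is constant, and differentiating this relation
shows that `deriv f` is constant as well, again by Picard's theorem. -/
theorem IsTranscendentalEntire.exists_apply_apply_eq (hf : IsTranscendentalEntire f) :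
    ∃ z, f (f z) = z := by
  by_contra! h
  have hfix : ∀ z, f z ≠ z := fun z hz => h z (by rw [hz, hz])
  have hd := hf.1
  obtain ⟨κ, hκ⟩ := exists_eq_const_of_forall_ne (F := fun z => (f (f z) - z) / (f z - z))
    (a := 0) (b := 1)
    (((hd.comp hd).sub differentiable_id).div (hd.sub differentiable_id)
      (fun z => sub_ne_zero.2 (hfix z))) zero_ne_one
    (fun z => div_ne_zero (sub_ne_zero.2 (h z)) (sub_ne_zero.2 (hfix z)))
    (fun z hz => hfix (f z) (by
      rw [div_eq_one_iff_eq (sub_ne_zero.2 (hfix z))] at hz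
      linear_combination hz))
  have hκ0 : κ ≠ 0 := fun h0 => by
    have h1 := hκ 0
    rw [h0] at h1
    exact div_ne_zero (sub_ne_zero.2 (h 0)) (sub_ne_zero.2 (hfix 0)) h1
  have hκ1 : 1 - κ ≠ 0 := fun h1 => by
    have h2 := hκ 0
    rw [← sub_eq_zero.1 h1, div_eq_one_iff_eq (sub_ne_zero.2 (hfix 0))] at h2
    exact hfix (f 0) (by linear_combination h2)
  have hrel : ∀ z, deriv f z * (deriv f (f z) - κ) = 1 - κ := by
    intro z
    have hfun : (fun z => f (f z) - z) = fun z => κ * (f z - z) := funext fun z => by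
      rw [← hκ z, div_mul_cancel₀ _ (sub_ne_zero.2 (hfix z))]
    have h1 : HasDerivAt (fun z => f (f z) - z) (deriv f (f z) * deriv f z - 1) z :=
      ((hd (f z)).hasDerivAt.comp z (hd z).hasDerivAt).sub (hasDerivAt_id z)
    have h2 : HasDerivAt (fun z => κ * (f z - z)) (κ * (deriv f z - 1)) z :=
      ((hd z).hasDerivAt.sub (hasDerivAt_id z)).const_mul κ
    rw [hfun] at h1
    linear_combination h1.unique h2
  obtain ⟨μ, hμ⟩ := exists_eq_const_of_forall_ne (F := fun z => deriv f (f z))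
    (hd.deriv.comp hd) hκ0.symm
    (fun z => left_ne_zero_of_mul (a := deriv f (f z)) (b := deriv f (f (f z)) - κ)
      (by rw [hrel]; exact hκ1))
    (fun z hz => hκ1 (by
      have h3 := hrel z
      rw [hz, sub_self, mul_zero] at h3
      exact h3.symm))
  have hconst : ∀ z, deriv f z = (1 - κ) / (μ - κ) := by
    intro z
    have h3 := hrel z
    rw [show deriv f (f z) = μ from hμ z] at h3
    have h4 : μ - κ ≠ 0 := fun h0 => hκ1 (by rw [← h3, h0, mul_zero])
    rw [eq_div_iff h4, h3]
  set d := (1 - κ) / (μ - κ) with hd'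
  refine hf.2 ⟨Polynomial.C d * Polynomial.X + Polynomial.C (f 0), fun z => ?_⟩
  have h5 := is_const_of_deriv_eq_zero (f := fun z => f z - d * z)
    (hd.sub (differentiable_id.const_mul d)) (fun w => by
      have h6 : HasDerivAt (fun z => f z - d * z) (deriv f w - d * 1) w :=
        (hd w).hasDerivAt.sub ((hasDerivAt_id w).const_mul d)
      rw [h6.deriv, hconst w]; ring) z 0
  simp only [Polynomial.eval_add, Polynomial.eval_mul, Polynomial.eval_C, Polynomial.eval_X]
  linear_combination h5

theorem IsTranscendentalEntire.juliaSet_nonempty (hf : IsTranscendentalEntire f)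
    (hI : (escapingSet f).Nonempty) : (juliaSet f).Nonempty := by
  by_contra hJ
  have hF : fatouSet f = univ := compl_empty_iff.1 (not_nonempty_iff_eq_empty.1 hJ)
  obtain ⟨z, hz⟩ := hf.exists_apply_apply_eq
  exact notMem_escapingSet_of_isPeriodicPt (n := 2) two_pos hz
    (by rw [escapingSet_eq_univ hF hI]; trivial)

/-! ### Circles around a point of the Julia set -/

/-- The level sets `{‖h‖ = R}` of a nonvanishing open map on a simply connected open set are never
compact: on such a set the imaginary part of a logarithm of `h` would attain a maximum, whereas by
openness `h` can be rotated slightly in the positive direction. -/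
theorem not_isCompact_level {U : Set ℂ} (hU : IsOpen U) (hUs : IsSimplyConnected U) {h : ℂ → ℂ}
    (hc : Continuous h) (ho : IsOpenMap h) (h0 : ∀ z ∈ U, h z ≠ 0) {R : ℝ}
    (hne : (U ∩ {z | ‖h z‖ = R}).Nonempty) : ¬ IsCompact (U ∩ {z | ‖h z‖ = R}) := by
  intro hcomp
  obtain ⟨g, hg, hgh⟩ := Complex.exists_continuousOn_eqOn_exp_comp hUs hU hc.continuousOn
    (by rintro ⟨z, hz, hz0⟩; exact h0 z hz hz0)
  have hexp : ∀ z ∈ U, Complex.exp (g z) = h z := fun z hz => hgh hz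
  obtain ⟨p, ⟨hpU, hpR⟩, hmax⟩ := hcomp.exists_isMaxOn hne (f := fun z => (g z).im)
    (Complex.continuous_im.comp_continuousOn (hg.mono inter_subset_left))
  have hV : U ∩ g ⁻¹' ball (g p) 1 ∈ 𝓝 p :=
    inter_mem (hU.mem_nhds hpU)
      ((hg.continuousAt (hU.mem_nhds hpU)).preimage_mem_nhds (ball_mem_nhds _ one_pos))
  have hrot : Tendsto (fun ε : ℝ => h p * Complex.exp (ε * Complex.I)) (𝓝[>] 0) (𝓝 (h p)) := by
    have : Continuous fun ε : ℝ => h p * Complex.exp (ε * Complex.I) := by fun_prop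
    simpa using (this.tendsto 0).mono_left nhdsWithin_le_nhds
  obtain ⟨ε, ⟨q, ⟨hqU, hqg⟩, hq⟩, hε0, hε1⟩ :=
    ((hrot.eventually_mem (ho.image_mem_nhds hV)).and
      (Ioo_mem_nhdsGT (zero_lt_one' ℝ))).exists
  have hqR : ‖h q‖ = R := by rw [hq, norm_mul, Complex.norm_exp_ofReal_mul_I, mul_one, hpR]
  rw [← hexp p hpU, ← hexp q hqU, ← Complex.exp_add, Complex.exp_eq_exp_iff_exists_int] at hq
  obtain ⟨m, hm⟩ := hq
  have him : (g q).im = (g p).im + ε + m * (2 * Real.pi) := by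
    rw [hm]; simp [Complex.mul_im, Complex.mul_re]
  have hlt : |(g q).im - (g p).im| < 1 := by
    rw [← Complex.sub_im]
    exact (Complex.abs_im_le_norm _).trans_lt (by simpa [dist_eq_norm] using hqg)
  have hle : (g q).im ≤ (g p).im := hmax ⟨hqU, hqR⟩
  -- The branches at `p` and `q` agree, being less than `2 * π` apart.
  have hm0 : m = 0 := by
    have h3 := Real.pi_gt_three
    rw [abs_lt] at hlt
    have h1 : -1 < m := by
      by_contra! hcon
      have : (m : ℝ) ≤ -1 := by exact_mod_cast hcon
      nlinarith
    have h2 : m < 1 := by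
      by_contra! hcon
      have : (1 : ℝ) ≤ m := by exact_mod_cast hcon
      nlinarith
    omega
  rw [hm0] at him
  simp only [Int.cast_zero, zero_mul, add_zero] at him
  linarith

theorem IsTranscendentalEntire.isOpenMap_iterate (hf : IsTranscendentalEntire f) (n : ℕ) :
    IsOpenMap f^[n] := by
  induction n with
  | zero => exact IsOpenMap.id
  | succ n ih => exact ih.comp hf.isOpenMap

theorem IsTranscendentalEntire.isOpenMap_iterate_sub (hf : IsTranscendentalEntire f) (n : ℕ)
    (c : ℂ) : IsOpenMap fun z => f^[n] z - c :=
  (Homeomorph.subRight c).isOpenMap.comp (hf.isOpenMap_iterate n)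

/-- If the Fatou component `U` of `x` is simply connected and `c` is a Julia point, then the circles
centred at `c` through points of `f^[n] '' U` which have `x` in their interior meet the Julia set.
A circle in the Fatou set would give a compact level set: of `f^[n] - c` on `U` if `U` is bounded,
and of `id - c` on `U` if `U` is unbounded. -/
theorem exists_mem_juliaSet_norm_sub_eq (hf : IsTranscendentalEntire f) {x c p : ℂ}
    (hx : x ∈ fatouSet f) (hs : IsSimplyConnected (connectedComponentIn (fatouSet f) x))
    (hc : c ∈ juliaSet f) (n : ℕ) (hp : p ∈ connectedComponentIn (fatouSet f) x)
    (hlt : ‖x - c‖ < ‖f^[n] p - c‖) :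
    ∃ c' ∈ juliaSet f, ‖c' - c‖ = ‖f^[n] p - c‖ := by
  set U := connectedComponentIn (fatouSet f) x with hUdef
  have hU : IsOpen U := isOpen_fatouSet.connectedComponentIn
  have hUF : U ⊆ fatouSet f := connectedComponentIn_subset _ _
  by_contra! hcon
  have hcirc : ∀ w, ‖w - c‖ = ‖f^[n] p - c‖ → w ∈ fatouSet f := fun w hw => by
    by_contra hwF
    exact hcon w hwF hw
  have hcont : Continuous f := hf.1.continuous
  have hinv : ∀ z, f^[n] z ∈ fatouSet f ↔ z ∈ fatouSet f := fun z =>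
    iterate_mem_fatouSet_iff hcont hf.isOpenMap n
  by_cases hbd : Bornology.IsBounded U
  · -- The part of `U` mapped into the circle is compact, as `f^[n]` maps the boundary of `U`
    -- into the Julia set.
    have hcn : Continuous fun z => f^[n] z - c := (hcont.iterate n).sub continuous_const
    refine not_isCompact_level hU hs hcn (hf.isOpenMap_iterate_sub n c)
      (fun z hz h0 => hc (sub_eq_zero.1 h0 ▸ (hinv z).2 (hUF hz))) ⟨p, hp, rfl⟩ ?_
    refine isCompact_of_isClosed_isBounded (isClosed_of_closure_subset fun z hz => ?_)
      (hbd.subset inter_subset_left)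
    have h1 : ‖f^[n] z - c‖ = ‖f^[n] p - c‖ :=
      (isClosed_eq hcn.norm continuous_const).closure_subset
        (closure_mono inter_subset_right hz)
    exact ⟨mem_component_of_mem_closure hx ((hinv z).1 (hcirc _ h1))
      (closure_mono inter_subset_left hz), h1⟩
  · -- The unbounded connected set `U` meets the circle, hence contains it.
    obtain ⟨y, hyU, hy⟩ : ∃ y ∈ U, ‖f^[n] p - c‖ < ‖y - c‖ := by
      by_contra! h
      exact hbd ((isBounded_closedBall (x := c) (r := ‖f^[n] p - c‖)).subset fun y hy => by
        simpa [dist_eq_norm] using h y hy)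
    obtain ⟨v, hvU, hv⟩ := isPreconnected_connectedComponentIn.intermediate_value
      (mem_connectedComponentIn hx) hyU
      (f := fun z => ‖z - c‖) (by fun_prop) ⟨hlt.le, hy.le⟩
    have hsphere : sphere c ‖f^[n] p - c‖ ⊆ U := by
      have hpre : IsPreconnected (sphere c ‖f^[n] p - c‖) :=
        isPreconnected_sphere (by rw [Complex.rank_real_complex]; norm_num) c _
      rw [hUdef, connectedComponentIn_eq hvU]
      exact hpre.subset_connectedComponentIn (by simpa [dist_eq_norm] using hv)
        fun w hw => hcirc w (by simpa [dist_eq_norm] using hw)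
    have heq : U ∩ {z | ‖z - c‖ = ‖f^[n] p - c‖} = sphere c ‖f^[n] p - c‖ := by
      ext w
      simp only [mem_inter_iff, mem_ofPred_eq, mem_sphere_iff_norm, and_iff_right_iff_imp]
      exact fun hw => hsphere (by simpa [dist_eq_norm] using hw)
    exact not_isCompact_level hU hs (h := fun z => z - c) (by fun_prop)
      (Homeomorph.subRight c).isOpenMap
      (fun z hz h0 => hc (sub_eq_zero.1 h0 ▸ hUF hz)) ⟨v, hvU, hv⟩
      (heq ▸ isCompact_sphere c _)

/-! ### Growth of the derivatives along the orbit -/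

theorem pow_mul_norm_le_norm_deriv_iterate (hf : Differentiable ℂ f) {w : ℂ} {l : ℝ} (hl : 0 ≤ l)
    (h : ∀ n, f (f^[n] w) ≠ 0 ∧ l ≤ ‖f^[n] w * (deriv f (f^[n] w) / f (f^[n] w))‖) (k : ℕ) :
    l ^ k * ‖f^[k] w‖ ≤ ‖deriv f^[k] w‖ * ‖w‖ := by
  induction k with
  | zero => simp
  | succ k ih =>
    obtain ⟨h0, hle⟩ := h k
    rw [← mul_div_assoc, norm_div, le_div_iff₀ (norm_pos_iff.2 h0), norm_mul] at hle
    have hderiv : deriv f^[k + 1] w = deriv f (f^[k] w) * deriv f^[k] w := by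
      rw [Function.iterate_succ']
      exact deriv_comp w (hf _) (hf.iterate k w)
    rw [hderiv, norm_mul, Function.iterate_succ_apply', pow_succ]
    calc l ^ k * l * ‖f (f^[k] w)‖ = l ^ k * (l * ‖f (f^[k] w)‖) := by ring
      _ ≤ l ^ k * (‖f^[k] w‖ * ‖deriv f (f^[k] w)‖) := by gcongr
      _ = ‖deriv f (f^[k] w)‖ * (l ^ k * ‖f^[k] w‖) := by ring
      _ ≤ ‖deriv f (f^[k] w)‖ * (‖deriv f^[k] w‖ * ‖w‖) := by gcongr
      _ = _ := by ring

/-- If a disc about `w` lies in the Fatou set and every circle centred at the Julia point `c` through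
an image point of `f^[k]` on the disc meets the Julia set, then a branch of `log (f^[k] - c)` covers
no disc of radius `4`, so its derivative at `w` is bounded independently of `k`. -/
theorem norm_deriv_iterate_mul_le (hf : IsTranscendentalEntire f) {w c : ℂ} {s : ℝ} (hs : 0 < s)
    (hsF : ball w s ⊆ fatouSet f) (hc : c ∈ juliaSet f) {k : ℕ}
    (hcirc : ∀ q ∈ ball w s, ∃ c' ∈ juliaSet f, ‖c' - c‖ = ‖f^[k] q - c‖) :
    ‖deriv f^[k] w‖ * s ≤ 96 * 4 * ‖f^[k] w - c‖ := by
  have hkF : ∀ q ∈ ball w s, f^[k] q ∈ fatouSet f := fun q hq =>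
    (iterate_mem_fatouSet_iff hf.1.continuous hf.isOpenMap k).2 (hsF hq)
  have h0 : ∀ q ∈ ball w s, f^[k] q - c ≠ 0 := fun q hq h =>
    hc (sub_eq_zero.1 h ▸ hkF q hq)
  obtain ⟨g, hg⟩ := exists_hasDerivAt_exp_eq_of_ball hs
    ((hf.1.iterate k).sub_const c).differentiableOn h0
  have hbloch := norm_deriv_mul_le_of_forall_not_ball_subset_image (ρ := 4) hs
    (fun q hq => (hg q hq).1.differentiableAt.differentiableWithinAt) (fun ω hω => by
      obtain ⟨q, hq, hqω⟩ := hω (mem_ball_self (by norm_num))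
      obtain ⟨c', hc', hcc'⟩ := hcirc q hq
      have hexp : Complex.exp ω = f^[k] q - c := by rw [← hqω, (hg q hq).2]
      have hne : c' - c ≠ 0 := norm_ne_zero_iff.1 (by rw [hcc']; exact norm_ne_zero_iff.2 (h0 q hq))
      -- `ω + log ((c' - c) / exp ω)` is a logarithm of `c' - c` on the vertical line through `ω`.
      set ζ := Complex.log ((c' - c) / Complex.exp ω) with hζ
      have hre : ζ.re = 0 := by
        rw [hζ, Complex.log_re, norm_div, hexp, hcc', div_self (norm_ne_zero_iff.2 (h0 q hq)),
          Real.log_one]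
      have him : |ζ.im| ≤ Real.pi := by rw [hζ, Complex.log_im]; exact Complex.abs_arg_le_pi _
      have hmem : ω + ζ ∈ ball ω 4 := by
        rw [mem_ball, dist_eq_norm, add_sub_cancel_left]
        have := Complex.norm_le_abs_re_add_abs_im ζ
        rw [hre, abs_zero] at this
        linarith [Real.pi_lt_four]
      obtain ⟨q', hq', hq'ω⟩ := hω hmem
      have h1 : f^[k] q' - c = c' - c := by
        rw [← (hg q' hq').2, hq'ω, Complex.exp_add, hζ,
          Complex.exp_log (div_ne_zero hne (Complex.exp_ne_zero _)),
          mul_div_cancel₀ _ (Complex.exp_ne_zero _)]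
      exact hc' (sub_left_injective h1 ▸ hkF q' hq'))
  rw [(hg w (mem_ball_self hs)).1.deriv, deriv_sub_const, norm_div, div_mul_eq_mul_div,
    div_le_iff₀ (norm_pos_iff.2 (h0 w (mem_ball_self hs)))] at hbloch
  exact hbloch

end EntireDynamics

theorem theorem3p1 (f : ℂ → ℂ) (hf : EntireDynamics.IsTranscendentalEntire f)
    (z₀ : ℂ) (hz₀ : z₀ ∈ EntireDynamics.escapingSet f)
    (horbit : ∃ l : ℝ, 1 < l ∧ ∃ N : ℕ, ∀ n : ℕ, N ≤ n →
      f (f^[n] z₀) ≠ 0 ∧ l ≤ ‖f^[n] z₀ * (deriv f (f^[n] z₀) / f (f^[n] z₀))‖) :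
    (∃ U : Set ℂ, EntireDynamics.IsMultiplyConnectedFatouComponent f U ∧ z₀ ∈ U) ∨
      z₀ ∈ EntireDynamics.juliaSet f := by
  open EntireDynamics Metric in
  refine or_iff_not_imp_right.2 fun hJ => ?_
  have hF : z₀ ∈ fatouSet f := not_not.1 hJ
  set U := connectedComponentIn (fatouSet f) z₀ with hU
  have hz₀U : z₀ ∈ U := mem_connectedComponentIn hF
  by_contra hmc
  have hs : IsSimplyConnected U := by
    by_contra h
    exact hmc ⟨U, ⟨⟨z₀, hF, rfl⟩, h⟩, hz₀U⟩
  obtain ⟨c, hc⟩ := hf.juliaSet_nonempty ⟨z₀, hz₀⟩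
  obtain ⟨r, hr, hrF, hesc⟩ := exists_ball_frequently_lt_norm_iterate hF hz₀
  have hrU : ball z₀ r ⊆ U :=
    (convex_ball z₀ r).isPreconnected.subset_connectedComponentIn (mem_ball_self hr) hrF
  obtain ⟨l, hl, N, hN⟩ := horbit
  -- `deriv f^[n] z₀` may vanish for `n ≤ N`, so the estimates are made near `f^[N] z₀`.
  set w := f^[N] z₀ with hw
  obtain ⟨s, hs0, hsub'⟩ := nhds_basis_ball.mem_iff.1
    ((hf.isOpenMap_iterate N).image_mem_nhds (ball_mem_nhds z₀ hr))
  have hsub : ∀ q ∈ ball w s, ∃ p ∈ ball z₀ r, f^[N] p = q := fun q hq => hsub' hq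
  have hiter : ∀ k z, f^[k] (f^[N] z) = f^[k + N] z := fun k z =>
    (Function.iterate_add_apply f k N z).symm
  have hgrowth := pow_mul_norm_le_norm_deriv_iterate hf.1 (w := w) (by linarith : 0 ≤ l)
    (fun n => by rw [hw, hiter]; exact hN _ (Nat.le_add_left _ _))
  have hpow : ∀ᶠ n in atTop, 96 * 4 * 2 * ‖w‖ / s < l ^ (n - N) :=
    ((tendsto_pow_atTop_atTop_of_one_lt hl).comp (tendsto_sub_atTop_nat N)).eventually_gt_atTop _
  have hlarge : ∀ᶠ n in atTop, ‖c‖ + 1 ≤ ‖f^[n] z₀‖ :=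
    (show Tendsto (fun n => ‖f^[n] z₀‖) atTop atTop from hz₀).eventually_ge_atTop _
  obtain ⟨n, hn, hpn, hln, hNn⟩ := ((hesc (‖c‖ + ‖z₀ - c‖)).and_eventually
    (hpow.and (hlarge.and (eventually_ge_atTop N)))).exists
  obtain ⟨k, rfl⟩ := Nat.exists_eq_add_of_le' hNn
  rw [Nat.add_sub_cancel] at hpn
  have hwk : f^[k] w = f^[k + N] z₀ := hiter k z₀
  have hle := norm_deriv_iterate_mul_le hf hs0 (c := c) (k := k) (w := w)
    (fun q hq => by
      obtain ⟨p, hp, rfl⟩ := hsub q hq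
      exact (iterate_mem_fatouSet_iff hf.1.continuous hf.isOpenMap N).2 (hrF hp)) hc
    (fun q hq => by
      obtain ⟨p, hp, rfl⟩ := hsub q hq
      rw [hiter]
      refine exists_mem_juliaSet_norm_sub_eq hf hF hs hc (k + N) (hrU hp) ?_
      have := norm_sub_norm_le (f^[k + N] p) c
      linarith [hn p hp])
  have h1 := hgrowth k
  rw [hwk] at h1 hle
  have h2 : ‖f^[k + N] z₀ - c‖ ≤ 2 * ‖f^[k + N] z₀‖ :=
    (norm_sub_le _ _).trans (by linarith)
  have hpos : 0 < ‖f^[k + N] z₀‖ := by linarith [norm_nonneg c]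
  rw [div_lt_iff₀ hs0] at hpn
  have h3 : l ^ k * s * ‖f^[k + N] z₀‖ ≤ 96 * 4 * 2 * ‖w‖ * ‖f^[k + N] z₀‖ :=
    calc l ^ k * s * ‖f^[k + N] z₀‖ = (l ^ k * ‖f^[k + N] z₀‖) * s := by ring
      _ ≤ ‖deriv f^[k] w‖ * ‖w‖ * s := by gcongr
      _ = ‖deriv f^[k] w‖ * s * ‖w‖ := by ring
      _ ≤ 96 * 4 * (2 * ‖f^[k + N] z₀‖) * ‖w‖ := by
        gcongr ?_ * _
        exact hle.trans (by gcongr)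
      _ = _ := by ring
  exact (lt_of_mul_lt_mul_right (h3.trans_lt (mul_lt_mul_of_pos_right hpn hpos)) hpos.le).false
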